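/- Let $M$ be a smooth $n$-dimensional manifold, $\hat g$ a smooth Riemannian metric on $M$, and $\bar g$ the Euclidean metric of $\mathbb{R}^n$. Conventions: $R(X,Y)Z=\nabla_X\nabla_YZ-\nabla_Y\nabla_XZ-\nabla_{[X,Y]}Z$ for the Levi-Civita connection $\nabla$ of $\hat g$, $\mathrm{Rm}(\hat g)(X,Y,Z,W)=\hat g(R(X,Y)Z,W)$, the Ricci tensor is the $\hat g$-trace of $\mathrm{Rm}(\hat g)$ on its first and last arguments, the scalar curvature $S(\hat g)$ is the trace of the Ricci tensor, and for symmetric 2-tensors $$(T\odot T')(X,Y,Z,W)=T(X,W)T'(Y,Z)+T(Y,Z)T'(X,W)-T(X,Z)T'(Y,W)-T(Y,W)T'(X,Z).$$ For conformal metrics $g_2=e^{2u}g_1$, the Osgood–Stowe tensor is $$\mathrm{OS}(g_2,g_1)=\mathrm{Hess}(u)-du\otimes du-\tfrac1n\left(\Delta u-|\nabla u|^2\right)g_1,$$ everything on the right being taken with respect to $g_1$. A conformal chart of $\hat g$ is a smooth chart $\varphi:U\to\mathbb{R}^n$ with $\hat g=e^{2u}\varphi^*\bar g$ on $U$ for some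 smooth $u:U\to\mathbb{R}$; $\hat g$ is locally conformally flat if every point of $M$ lies in the domain of a conformal chart. (i) Suppose $n\ge 3$ and $\hat g$ is locally conformally flat. Let $\mathrm{OS}(\hat g)$ be the tensor on $M$ whose value at each point is that of $\mathrm{OS}(\hat g,\varphi^*\bar g)$ for a conformal chart $\varphi$ around the point (for $n \geq 3$ the choice of $\varphi$ does not matter). If $\hat B$ is the endomorphism field of $TM$ with $$\hat g(\hat BX,Y)=2\,\mathrm{OS}(\hat g)(X,Y)-\frac{S(\hat g)}{n(n-1)}\,\hat g(X,Y),$$ then, with $\hat{I\!\!I}(X,Y)=\hat g(\hat BX,Y)$, the pair $(\hat g,\hat B)$ solves the Gauss equation at infinity $$\mathrm{Rm}(\hat g)=-\tfrac12\,\hat g\odot\hat{I\!\!I}.$$ (ii) The same holds for $n=2$ once a Möbius structure compatible with $\hat g$ (for instance a complex projective structure) has been chosen, that is, an atlas of conformal charts of $\hat g$ whose transition maps are locally restrictions of Möbius transformations of $\mathbb{R}^2\cup\{\infty\}$, with $\mathrm{OS}(\hat g)$ formed from the charts of this atlas. -/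

import Mathlib

open scoped Manifold ContDiff Topology

noncomputable section

namespace GaussInfinity

/-- Euclidean `n`-space, the model of `n`-manifolds. -/
abbrev E (n : ℕ) : Type := EuclideanSpace ℝ (Fin n)

/-! ### Riemannian geometry in coordinates

Here `G : E n → E n →L[ℝ] E n →L[ℝ] ℝ` is the field of bilinear forms expressing a Riemannian
metric in a coordinate system; `G` only matters near the point of evaluation. -/

section Coordinates

variable {n : ℕ}

/-- The Christoffel symbols of the Levi-Civita connection of `G`: the vector `Γ(v, w)` with
`G (Γ(v, w), z) = (∂_v G (w, z) + ∂_w G (v, z) - ∂_z G (v, w)) / 2` for all `z`.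
(Viewing `G x` as a map to the dual space, `(G x).inverse` raises an index.) -/
def christoffel (G : E n → E n →L[ℝ] E n →L[ℝ] ℝ) (x v w : E n) : E n :=
  (G x).inverse ((1 / 2 : ℝ) •
    (fderiv ℝ G x v w + fderiv ℝ G x w v - ((fderiv ℝ G x).flip v).flip w))

/-- The Levi-Civita covariant derivative `∇_X Y` of vector fields in coordinates. -/
def covDeriv (G : E n → E n →L[ℝ] E n →L[ℝ] ℝ) (X Y : E n → E n) (x : E n) : E n :=
  fderiv ℝ Y x (X x) + christoffel G x (X x) (Y x)

/-- The curvature `R(X, Y) Z = ∇_X ∇_Y Z - ∇_Y ∇_X Z - ∇_[X, Y] Z`. -/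
def curvature (G : E n → E n →L[ℝ] E n →L[ℝ] ℝ) (X Y Z : E n → E n) (x : E n) : E n :=
  covDeriv G X (covDeriv G Y Z) x - covDeriv G Y (covDeriv G X Z) x
    - covDeriv G (VectorField.lieBracket ℝ X Y) Z x

/-- The full curvature tensor `Rm(v, w, z, t) = G (R(v, w) z, t)` at `x`, the vectors being
extended to vector fields with constant coefficients. -/
def localRm (G : E n → E n →L[ℝ] E n →L[ℝ] ℝ) (x v w z t : E n) : ℝ :=
  G x (curvature G (fun _ => v) (fun _ => w) (fun _ => z) x) t

/-- The trace `tr_G T = ∑_{i,j} G^{ij} T_{ij}` of a 2-tensor with respect to the metric `G`.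
The vector with coordinates `(G^{ij})_j` is obtained by raising the `i`-th coordinate covector. -/
def traceWrt (G : E n →L[ℝ] E n →L[ℝ] ℝ) (T : E n → E n → ℝ) : ℝ :=
  ∑ i : Fin n, ∑ j : Fin n, G.inverse (EuclideanSpace.proj i) j *
    T (EuclideanSpace.single i 1) (EuclideanSpace.single j 1)

/-- The Ricci tensor: trace of the curvature tensor on its first and last slots. -/
def localRicci (G : E n → E n →L[ℝ] E n →L[ℝ] ℝ) (x v w : E n) : ℝ :=
  traceWrt (G x) (fun a b => localRm G x a v w b)

/-- The scalar curvature: trace of the Ricci tensor. -/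
def localScalar (G : E n → E n →L[ℝ] E n →L[ℝ] ℝ) (x : E n) : ℝ :=
  traceWrt (G x) (localRicci G x)

/-- The Hessian `Hess(u)(v, w) = ∂_v ∂_w u - du (Γ(v, w))`. -/
def localHess (G : E n → E n →L[ℝ] E n →L[ℝ] ℝ) (u : E n → ℝ) (x v w : E n) : ℝ :=
  fderiv ℝ (fderiv ℝ u) x v w - fderiv ℝ u x (christoffel G x v w)

/-- The Laplacian: trace of the Hessian. -/
def localLaplacian (G : E n → E n →L[ℝ] E n →L[ℝ] ℝ) (u : E n → ℝ) (x : E n) : ℝ :=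
  traceWrt (G x) (localHess G u x)

/-- The gradient of `u` with respect to `G`. -/
def localGrad (G : E n → E n →L[ℝ] E n →L[ℝ] ℝ) (u : E n → ℝ) (x : E n) : E n :=
  (G x).inverse (fderiv ℝ u x)

/-- The Osgood–Stowe tensor of `exp (2 u) G` with respect to `G`: the trace-free part of
`Hess(u) - du ⊗ du`. -/
def localOS (G : E n → E n →L[ℝ] E n →L[ℝ] ℝ) (u : E n → ℝ) (x v w : E n) : ℝ :=
  localHess G u x v w - fderiv ℝ u x v * fderiv ℝ u x w
    - (1 / (n : ℝ)) *
      (localLaplacian G u x - G x (localGrad G u x) (localGrad G u x)) * G x v w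

end Coordinates

/-! ### Tensors on a manifold -/

section Manifold

variable {n : ℕ} {M : Type*} [TopologicalSpace M] [ChartedSpace (E n) M]

variable (n M) in
/-- Fields of bilinear forms on the tangent spaces of `M`. -/
abbrev BilinField : Type _ :=
  (p : M) → TangentSpace (𝓡 n) p →L[ℝ] TangentSpace (𝓡 n) p →L[ℝ] ℝ

/-- The coordinate expression of `h` in the chart `e`, i.e. its pullback by `e.symm`. -/
def inChart (e : OpenPartialHomeomorph M (E n)) (h : BilinField n M) :
    E n → E n →L[ℝ] E n →L[ℝ] ℝ := fun y =>
  ContinuousLinearMap.bilinearComp (E := E n) (F := E n) (E' := E n) (F' := E n)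
    (h (e.symm y)) (mfderiv (𝓡 n) (𝓡 n) e.symm y) (mfderiv (𝓡 n) (𝓡 n) e.symm y)

/-- The coordinates of a tangent vector at `p` in the chart at `p`. -/
def coord (p : M) (v : TangentSpace (𝓡 n) p) : E n :=
  mfderiv (𝓡 n) (𝓡 n) (chartAt (E n) p) p v

/-- The full curvature tensor `Rm(X, Y, Z, W) = g (R(X, Y) Z, W)` of the metric `g`. -/
def Rm (g : BilinField n M) (p : M) (X Y Z W : TangentSpace (𝓡 n) p) : ℝ :=
  localRm (inChart (chartAt (E n) p) g) (chartAt (E n) p p)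
    (coord p X) (coord p Y) (coord p Z) (coord p W)

/-- The scalar curvature of the metric `g`. -/
def scalarCurvature (g : BilinField n M) (p : M) : ℝ :=
  localScalar (inChart (chartAt (E n) p) g) (chartAt (E n) p p)

/-- The Osgood–Stowe tensor `OS(exp (2 u) g₁, g₁)` of two conformal metrics. -/
def OS (g₁ : BilinField n M) (u : M → ℝ) (p : M) (X Y : TangentSpace (𝓡 n) p) : ℝ :=
  localOS (inChart (chartAt (E n) p) g₁) (u ∘ (chartAt (E n) p).symm) (chartAt (E n) p p)
    (coord p X) (coord p Y)

/-- The Kulkarni–Nomizu product of two 2-tensors. -/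
def kulkarniNomizu {V : Type*} (T S : V → V → ℝ) (X Y Z W : V) : ℝ :=
  T X W * S Y Z + T Y Z * S X W - T X Z * S Y W - T Y W * S X Z

/-! ### Conformal charts -/

/-- The pullback `φ^* ḡ` of the Euclidean metric by a chart (meaningful on `φ.source`). -/
def pullbackEuclidean (φ : OpenPartialHomeomorph M (E n)) : BilinField n M := fun p =>
  ContinuousLinearMap.bilinearComp (E := E n) (F := E n) (E' := E n) (F' := E n)
    (innerSL ℝ) (mfderiv (𝓡 n) (𝓡 n) φ p) (mfderiv (𝓡 n) (𝓡 n) φ p)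

/-- `φ` is a smooth chart on which `g = exp (2 u) φ^* ḡ` with `u` smooth. -/
structure IsConformalChartWith (g : BilinField n M) (φ : OpenPartialHomeomorph M (E n))
    (u : M → ℝ) : Prop where
  mem_maximalAtlas : φ ∈ IsManifold.maximalAtlas (𝓡 n) ∞ M
  contMDiffOn : ContMDiffOn (𝓡 n) 𝓘(ℝ, ℝ) ∞ u φ.source
  eq_exp : ∀ p ∈ φ.source, ∀ v w : TangentSpace (𝓡 n) p,
    g p v w = Real.exp (2 * u p) * pullbackEuclidean φ p v w

/-- The set of all charts on which `g` is conformal to the pullback of the Euclidean metric. -/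
def conformalCharts (g : BilinField n M) : Set (OpenPartialHomeomorph M (E n)) :=
  {φ | ∃ u : M → ℝ, IsConformalChartWith g φ u}

/-- `g` is locally conformally flat: every point has a chart in which `g` is conformal to the
pullback of the Euclidean metric. -/
def IsLocallyConformallyFlat (g : BilinField n M) : Prop :=
  ∀ p : M, ∃ φ ∈ conformalCharts g, p ∈ φ.source

open Classical in
/-- The Osgood–Stowe tensor of `g` with respect to a family `𝒜` of conformal charts covering `M`:
at `p` it is `OS(g, φ^* ḡ)`, where `φ ∈ 𝒜` is a chart around `p` and `g = exp (2 u) φ^* ḡ`.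
When the transition maps of `𝒜` are Möbius transformations (which is automatic if `n ≥ 3`), the
value does not depend on the chart. -/
def OSRel (g : BilinField n M) (𝒜 : Set (OpenPartialHomeomorph M (E n))) (p : M)
    (X Y : TangentSpace (𝓡 n) p) : ℝ :=
  if h : ∃ c : OpenPartialHomeomorph M (E n) × (M → ℝ),
      c.1 ∈ 𝒜 ∧ p ∈ c.1.source ∧ IsConformalChartWith g c.1 c.2 then
    OS (pullbackEuclidean h.choose.1) h.choose.2 p X Y
  else 0

/-- The Osgood–Stowe tensor `OS(g)` of a locally conformally flat metric in dimension `≥ 3`. -/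
def OSGlobal (g : BilinField n M) (p : M) (X Y : TangentSpace (𝓡 n) p) : ℝ :=
  OSRel g (conformalCharts g) p X Y

/-! ### Möbius structures -/

open Classical in
/-- Inversion in the sphere of centre `c` and radius `r`, on the one-point compactification. -/
def sphereInversion (c : E n) (r : ℝ) : OnePoint (E n) → OnePoint (E n)
  | none => (c : OnePoint (E n))
  | some x => if x = c then OnePoint.infty else (EuclideanGeometry.inversion c r x : E n)

/-- Reflection in the hyperplane `⟪v, x⟫ = t` (a sphere through the point at infinity). -/
def hyperplaneReflection (v : E n) (t : ℝ) : OnePoint (E n) → OnePoint (E n) :=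
  OnePoint.map fun x => x - (2 * (inner ℝ v x - t) / ‖v‖ ^ 2) • v

/-- Möbius transformations of `S^n = ℝ^n ∪ {∞}`: compositions of inversions in spheres. -/
inductive IsMobius : (OnePoint (E n) → OnePoint (E n)) → Prop
  | id : IsMobius id
  | inversion (c : E n) (r : ℝ) (hr : 0 < r) (f : OnePoint (E n) → OnePoint (E n))
      (hf : IsMobius f) : IsMobius (sphereInversion c r ∘ f)
  | reflection (v : E n) (t : ℝ) (hv : v ≠ 0) (f : OnePoint (E n) → OnePoint (E n))
      (hf : IsMobius f) : IsMobius (hyperplaneReflection v t ∘ f)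

/-- `𝒜` is a Möbius structure on `M` compatible with `g`: an atlas of conformal charts whose
transition maps are locally restrictions of Möbius transformations. -/
structure IsMobiusAtlas (g : BilinField n M) (𝒜 : Set (OpenPartialHomeomorph M (E n))) :
    Prop where
  conformal : 𝒜 ⊆ conformalCharts g
  covers : ∀ p : M, ∃ φ ∈ 𝒜, p ∈ φ.source
  transition : ∀ φ ∈ 𝒜, ∀ ψ ∈ 𝒜, ∀ p ∈ φ.source ∩ ψ.source,
    ∃ m : OnePoint (E n) → OnePoint (E n), IsMobius m ∧
      ∀ᶠ q in 𝓝 p, (ψ q : OnePoint (E n)) = m (φ q)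

/-! ### The Gauss equation at infinity -/

/-- The 2-tensor `g B (X, Y) = g (B X, Y)`. -/
def lower (g : BilinField n M) (B : (p : M) → TangentSpace (𝓡 n) p →L[ℝ] TangentSpace (𝓡 n) p)
    (p : M) (X Y : TangentSpace (𝓡 n) p) : ℝ :=
  g p (B p X) Y

/-- `(g, B)` solves the Gauss equation at infinity `Rm(g) = -(1/2) g ⊙ II`, with `II = g B` and
`⊙` the Kulkarni–Nomizu product. -/
def SolvesGaussAtInfinity (g : BilinField n M)
    (B : (p : M) → TangentSpace (𝓡 n) p →L[ℝ] TangentSpace (𝓡 n) p) : Prop :=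
  ∀ (p : M) (X Y Z W : TangentSpace (𝓡 n) p),
    Rm g p X Y Z W = -(1 / 2 : ℝ) * kulkarniNomizu (fun v w => g p v w) (lower g B p) X Y Z W

end Manifold

end GaussInfinity

end

open scoped Manifold ContDiff Topology

noncomputable section

namespace GaussInfinity

section Coordinates

variable {n : ℕ}

/-! In the chart `e` at `p`, put `P = D(φ ∘ e.symm)`. The flat metric `φ^* ḡ` is then `G₁ = ⟨P ·, P
·⟩`, and the given one is `G = exp (2u) G₁`. Of `P` only smoothness, invertibility and the symmetry
of `DP` matter. Applying `P` moves every computation into Euclidean space, where, with `N = P (grad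
u)`, `P Γ(a, b) = DP(a, b) + du(a) P b + du(b) P a - ⟨P a, P b⟩ N` (`map_christoffel`).
Differentiating once more and antisymmetrising cancels the second derivatives of `P` (flatness of
`G₁`) and leaves `Rm = -G ⊙ s` with `s = Hess u - du ⊗ du + |du|² G₁ / 2` (`localRm_exp_smul`). Two
contractions give `S = -2 (n - 1) tr_G s` (`localScalar_of_localRm`), and `exp (2u) tr_G s = Δu -
|du|² + n |du|² / 2`. So subtracting `S G / (n (n - 1))` from `2 OS` restores exactly the trace that
`OS` lacks: the result is `2 s`, which is the Gauss equation. The identity holds for each conformal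
chart separately, so whichever chart `OSRel` selects will do, for `n = 2` as for `n ≥ 3`. -/

lemma differentiableAt_fderiv {V F : Type*} [NormedAddCommGroup V] [NormedSpace ℝ V]
    [NormedAddCommGroup F] [NormedSpace ℝ F] {f : V → F} {x : V} (hf : ContDiffAt ℝ ∞ f x) :
    DifferentiableAt ℝ (fderiv ℝ f) x :=
  (hf.fderiv_right (m := ∞) (by simp)).differentiableAt (by simp)

/-! ### Pullbacks of the Euclidean metric -/

/-- The pullback of the Euclidean inner product by a linear map. -/
def innerPullback (P : E n →L[ℝ] E n) : E n →L[ℝ] E n →L[ℝ] ℝ :=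
  (innerSL ℝ).bilinearComp P P

@[simp] lemma innerPullback_apply (P : E n →L[ℝ] E n) (v w : E n) :
    innerPullback P v w = inner ℝ (P v) (P w) := rfl

lemma contDiff_innerPullback : ContDiff ℝ ∞ (innerPullback (n := n)) := by
  refine contDiff_clm_apply_iff.2 fun v => contDiff_clm_apply_iff.2 fun w => ?_
  exact ContDiff.inner ℝ (f := fun P : E n →L[ℝ] E n => P v) (g := fun P => P w)
    (by fun_prop) (by fun_prop)

lemma contDiff_smul_innerPullback :
    ContDiff ℝ ∞ (fun q : ℝ × (E n →L[ℝ] E n) => q.1 • innerPullback q.2) := by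
  refine contDiff_clm_apply_iff.2 fun v => contDiff_clm_apply_iff.2 fun w => ?_
  exact contDiff_fst.mul (ContDiff.inner ℝ (f := fun q : ℝ × (E n →L[ℝ] E n) => q.2 v)
    (g := fun q => q.2 w) (by fun_prop) (by fun_prop))

lemma bilin_isInvertible_of_bijective {G : E n →L[ℝ] E n →L[ℝ] ℝ}
    (h : Function.Bijective G) : G.IsInvertible :=
  ⟨(LinearEquiv.ofBijective (G : E n →ₗ[ℝ] E n →L[ℝ] ℝ) h).toContinuousLinearEquiv, by
    ext; rfl⟩

lemma isInvertible_smul_innerPullback {P : E n →L[ℝ] E n} (hP : P.IsInvertible) {c : ℝ}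
    (hc : c ≠ 0) : (c • innerPullback P).IsInvertible := by
  obtain ⟨P, rfl⟩ := hP
  refine bilin_isInvertible_of_bijective ⟨?_, fun l => ?_⟩
  · refine (injective_iff_map_eq_zero _).2 fun v hv => ?_
    have := DFunLike.congr_fun hv v
    simpa [hc] using this
  · refine ⟨c⁻¹ • P.symm ((InnerProductSpace.toDual ℝ (E n)).symm
      (l.comp (P.symm : E n →L[ℝ] E n))), ?_⟩
    ext w
    simp [hc]

lemma isInvertible_innerPullback {P : E n →L[ℝ] E n} (hP : P.IsInvertible) :
    (innerPullback P).IsInvertible := by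
  simpa using isInvertible_smul_innerPullback hP one_ne_zero

/-! ### Levi-Civita connection, gradient and Hessian -/

/-- The derivative of a conformally rescaled pullback of the Euclidean metric. -/
lemma fderiv_exp_smul_innerPullback {P : E n → E n →L[ℝ] E n} {u : E n → ℝ}
    {G : E n → E n →L[ℝ] E n →L[ℝ] ℝ} {y : E n}
    (hG : G =ᶠ[𝓝 y] fun z => Real.exp (2 * u z) • innerPullback (P z))
    (hP : DifferentiableAt ℝ P y) (hu : DifferentiableAt ℝ u y) (a b c : E n) :
    fderiv ℝ G y a b c = Real.exp (2 * u y) *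
      (2 * fderiv ℝ u y a * inner ℝ (P y b) (P y c)
        + inner ℝ (fderiv ℝ P y a b) (P y c) + inner ℝ (P y b) (fderiv ℝ P y a c)) := by
  have hd : DifferentiableAt ℝ (fun z => Real.exp (2 * u z) • innerPullback (P z)) y :=
    ((contDiff_smul_innerPullback.differentiable (by simp)) _).comp
      (f := fun z => (Real.exp (2 * u z), P z)) y ((hu.const_mul 2).exp.prodMk hP)
  rw [hG.fderiv_eq]
  have h1 := (((hd.hasFDerivAt.clm_apply (hasFDerivAt_const b y)).clm_apply
    (hasFDerivAt_const c y)))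
  have hb := hP.hasFDerivAt.clm_apply (hasFDerivAt_const b y)
  have hc := hP.hasFDerivAt.clm_apply (hasFDerivAt_const c y)
  have h2 := ((hu.hasFDerivAt.const_mul 2).exp.mul (hb.inner ℝ hc))
  have := DFunLike.congr_fun (h1.unique h2) a
  simp at this
  rw [this]
  ring

lemma christoffel_eq {G : E n → E n →L[ℝ] E n →L[ℝ] ℝ} {y a b γ : E n}
    (hG : (G y).IsInvertible)
    (h : ∀ z, G y γ z = (1 / 2 : ℝ) *
      (fderiv ℝ G y a b z + fderiv ℝ G y b a z - fderiv ℝ G y z a b)) :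
    christoffel G y a b = γ := by
  have : (1 / 2 : ℝ) • (fderiv ℝ G y a b + fderiv ℝ G y b a - ((fderiv ℝ G y).flip a).flip b)
      = G y γ := by
    ext z
    simp [h]
  rw [christoffel, this]
  exact hG.inverse_apply_eq.2 rfl

/-- The Christoffel symbols of a conformally rescaled pullback of the Euclidean metric; `N` is the
image of the gradient of the conformal factor. -/
lemma map_christoffel {P : E n → E n →L[ℝ] E n} {u : E n → ℝ}
    {G : E n → E n →L[ℝ] E n →L[ℝ] ℝ} {y : E n}
    (hG : G =ᶠ[𝓝 y] fun z => Real.exp (2 * u z) • innerPullback (P z))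
    (hP : DifferentiableAt ℝ P y) (hu : DifferentiableAt ℝ u y) (hi : (P y).IsInvertible)
    (hs : ∀ a b, fderiv ℝ P y a b = fderiv ℝ P y b a) {N : E n}
    (hN : ∀ z, inner ℝ N (P y z) = fderiv ℝ u y z) (a b : E n) :
    P y (christoffel G y a b) = fderiv ℝ P y a b + fderiv ℝ u y a • P y b
      + fderiv ℝ u y b • P y a - (inner ℝ (P y a) (P y b) : ℝ) • N := by
  have hGy : G y = Real.exp (2 * u y) • innerPullback (P y) := hG.self_of_nhds
  set R := fderiv ℝ P y a b + fderiv ℝ u y a • P y b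
      + fderiv ℝ u y b • P y a - (inner ℝ (P y a) (P y b) : ℝ) • N with hR
  obtain ⟨γ, hγ⟩ : ∃ γ, P y γ = R := by
    obtain ⟨e, he⟩ := hi
    exact ⟨e.symm R, by rw [← he]; simp⟩
  rw [christoffel_eq (γ := γ), hγ]
  · rw [hGy]; exact isInvertible_smul_innerPullback hi (Real.exp_pos _).ne'
  · intro z
    simp only [fderiv_exp_smul_innerPullback hG hP hu, hGy]
    -- In the Koszul formula the symmetry of `DP` cancels the terms where `DP` is applied to `z`,
    -- leaving `⟨DP(a, b), P z⟩`.
    simp only [smul_apply, innerPullback_apply, hγ, hR, smul_eq_mul,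
      inner_add_left, inner_sub_left, inner_smul_left, hN, hs z a, hs z b, hs b a]
    simp only [real_inner_comm (P y z), conj_trivial,
      real_inner_comm (fderiv ℝ P y a z) (P y b), real_inner_comm (fderiv ℝ P y b z) (P y a)]
    ring

lemma eventually_isInvertible {P : E n → E n →L[ℝ] E n} {x : E n}
    (hP : ContinuousAt P x) (hi : (P x).IsInvertible) : ∀ᶠ y in 𝓝 x, (P y).IsInvertible := by
  obtain ⟨e, he⟩ := hi
  exact hP.eventually
    (he ▸ ContinuousLinearEquiv.nhds e : {f : E n →L[ℝ] E n | f.IsInvertible} ∈ 𝓝 (P x))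

/-- The pushed-forward gradient, as a vector field along `P`. -/
lemma exists_gradient {P : E n → E n →L[ℝ] E n} {u : E n → ℝ} {x : E n}
    (hP : ContDiffAt ℝ ∞ P x) (hu : ContDiffAt ℝ ∞ u x) (hi : (P x).IsInvertible) :
    ∃ N : E n → E n, DifferentiableAt ℝ N x ∧
      (∀ᶠ y in 𝓝 x, ∀ z, inner ℝ (N y) (P y z) = fderiv ℝ u y z) ∧
      N x = P x ((innerPullback (P x)).inverse (fderiv ℝ u x)) := by
  have hev := eventually_isInvertible hP.continuousAt hi
  refine ⟨fun y => P y ((innerPullback (P y)).inverse (fderiv ℝ u y)), ?_, ?_, rfl⟩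
  · have h2 : ContDiffAt ℝ ∞ (fun y => innerPullback (P y)) x :=
      contDiff_innerPullback.contDiffAt.comp x hP
    have h3 : ContDiffAt ℝ ∞ (fun y => (innerPullback (P y)).inverse) x :=
      ContDiffAt.comp x
        (ContinuousLinearMap.IsInvertible.contDiffAt_map_inverse
          (isInvertible_innerPullback hi)) h2
    have h4 := differentiableAt_fderiv hu
    have h5 := h3.differentiableAt (by simp)
    have h6 := hP.differentiableAt (by simp)
    fun_prop
  · filter_upwards [hev] with y hy z
    have : innerPullback (P y) ((innerPullback (P y)).inverse (fderiv ℝ u y)) = fderiv ℝ u y := by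
      simpa using ((isInvertible_innerPullback hy).inverse_apply_eq
        (y := fderiv ℝ u y)).1 rfl |>.symm
    exact DFunLike.congr_fun this z

lemma two_le_infty : (2 : WithTop ℕ∞) ≤ ∞ := by
  exact WithTop.coe_le_coe.2 (le_top : (2 : ℕ∞) ≤ ⊤)

/-- Differentiate `⟨N, P b⟩ = du(b)` in the direction `a`. This removes `DN` from the curvature in
favour of the Hessian of `u`. -/
lemma inner_fderiv_gradient {P : E n → E n →L[ℝ] E n} {u : E n → ℝ} {x : E n}
    (hP : ContDiffAt ℝ ∞ P x) (hu : ContDiffAt ℝ ∞ u x) {N : E n → E n}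
    (hNd : DifferentiableAt ℝ N x)
    (hN : ∀ᶠ y in 𝓝 x, ∀ z, inner ℝ (N y) (P y z) = fderiv ℝ u y z) (a b : E n) :
    inner ℝ (fderiv ℝ N x a) (P x b) =
      fderiv ℝ (fderiv ℝ u) x a b - inner ℝ (N x) (fderiv ℝ P x a b) := by
  have h1 := (differentiableAt_fderiv hu).hasFDerivAt.clm_apply (hasFDerivAt_const b x)
  have h2 := hNd.hasFDerivAt.inner ℝ
    ((hP.differentiableAt (by simp)).hasFDerivAt.clm_apply (hasFDerivAt_const b x))
  have h3 := h2.congr_of_eventuallyEq (hN.mono fun y hy => (hy b).symm)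
  have h4 := DFunLike.congr_fun (h1.unique h3) a
  simp at h4
  rw [h4]
  ring

lemma localHess_innerPullback {P : E n → E n →L[ℝ] E n} {u : E n → ℝ}
    {G₁ : E n → E n →L[ℝ] E n →L[ℝ] ℝ} {x : E n}
    (hG₁ : G₁ =ᶠ[𝓝 x] fun z => innerPullback (P z))
    (hP : DifferentiableAt ℝ P x) (hi : (P x).IsInvertible)
    (hs : ∀ a b, fderiv ℝ P x a b = fderiv ℝ P x b a) {N : E n}
    (hN : ∀ z, inner ℝ N (P x z) = fderiv ℝ u x z) (a b : E n) :
    localHess G₁ u x a b =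
      fderiv ℝ (fderiv ℝ u) x a b - inner ℝ N (fderiv ℝ P x a b) := by
  have hΓ : P x (christoffel G₁ x a b) = fderiv ℝ P x a b := by
    -- The flat metric is the case of conformal factor 1, with zero gradient.
    have := map_christoffel (u := fun _ => 0) (G := G₁) (N := 0) (by simpa using hG₁) hP
      (by fun_prop) hi hs (by simp) a b
    simpa using this
  rw [localHess, ← hN, hΓ]

/-! ### Curvature of a conformally flat metric -/

lemma christoffel_zero_left (G : E n → E n →L[ℝ] E n →L[ℝ] ℝ) (x w : E n) :
    christoffel G x 0 w = 0 := by
  have : (fderiv ℝ G x 0 w + fderiv ℝ G x w 0 - ((fderiv ℝ G x).flip 0).flip w) = 0 := by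
    ext; simp
  rw [christoffel, this]
  simp

lemma curvature_const (G : E n → E n →L[ℝ] E n →L[ℝ] ℝ) (x a b c : E n) :
    curvature G (fun _ => a) (fun _ => b) (fun _ => c) x =
      (fderiv ℝ (fun y => christoffel G y b c) x a + christoffel G x a (christoffel G x b c))
      - (fderiv ℝ (fun y => christoffel G y a c) x b
        + christoffel G x b (christoffel G x a c)) := by
  have h (b : E n) : covDeriv G (fun _ => b) (fun _ => c) = fun y => christoffel G y b c := by
    ext1 y
    simp [covDeriv]
  have h0 : VectorField.lieBracket ℝ (fun _ : E n => a) (fun _ => b) x = 0 := by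
    simp [VectorField.lieBracket]
  rw [curvature, h, h]
  simp [covDeriv, h0, christoffel_zero_left]

/-- The derivative of the image under `P` of the covariant derivative of constant fields. -/
lemma map_covDeriv_christoffel {P : E n → E n →L[ℝ] E n} {u : E n → ℝ}
    {G : E n → E n →L[ℝ] E n →L[ℝ] ℝ} {x : E n}
    (hG : G =ᶠ[𝓝 x] fun z => Real.exp (2 * u z) • innerPullback (P z))
    (hP : ContDiffAt ℝ ∞ P x) (hu : ContDiffAt ℝ ∞ u x) (hi : (P x).IsInvertible)
    (hs : ∀ᶠ y in 𝓝 x, ∀ a b, fderiv ℝ P y a b = fderiv ℝ P y b a) {N : E n → E n}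
    (hNd : DifferentiableAt ℝ N x)
    (hN : ∀ᶠ y in 𝓝 x, ∀ z, inner ℝ (N y) (P y z) = fderiv ℝ u y z) (a b c W : E n)
    (hW : W = fderiv ℝ P x b c + fderiv ℝ u x b • P x c
      + fderiv ℝ u x c • P x b - (inner ℝ (P x b) (P x c) : ℝ) • N x) :
    P x (fderiv ℝ (fun y => christoffel G y b c) x a
        + christoffel G x a (christoffel G x b c)) =
      fderiv ℝ (fderiv ℝ P) x a b c
      + (fderiv ℝ (fderiv ℝ u) x a b • P x c + fderiv ℝ u x b • fderiv ℝ P x a c)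
      + (fderiv ℝ (fderiv ℝ u) x a c • P x b + fderiv ℝ u x c • fderiv ℝ P x a b)
      - ((inner ℝ (fderiv ℝ P x a b) (P x c) + inner ℝ (P x b) (fderiv ℝ P x a c) : ℝ) • N x
        + (inner ℝ (P x b) (P x c) : ℝ) • fderiv ℝ N x a)
      + fderiv ℝ u x a • W + (inner ℝ (N x) W : ℝ) • P x a - (inner ℝ (P x a) W : ℝ) • N x := by
  have hPd := hP.differentiableAt (by simp)
  have hud := hu.differentiableAt (by simp)
  have hP' : ∀ᶠ y in 𝓝 x, ContDiffAt ℝ 1 P y :=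
    (hP.of_le (by exact_mod_cast le_top)).eventually (by simp)
  have hu' : ∀ᶠ y in 𝓝 x, ContDiffAt ℝ 1 u y :=
    (hu.of_le (by exact_mod_cast le_top)).eventually (by simp)
  -- Needed on a neighbourhood, since this identity is differentiated at `x`.
  have hΓ : ∀ᶠ y in 𝓝 x, ∀ b c, P y (christoffel G y b c) =
      fderiv ℝ P y b c + fderiv ℝ u y b • P y c
      + fderiv ℝ u y c • P y b - (inner ℝ (P y b) (P y c) : ℝ) • N y := by
    filter_upwards [hG.eventually_nhds, hP', hu', eventually_isInvertible hP.continuousAt hi,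
      hs, hN] with y h1 h2 h3 h4 h5 h6 b c
    exact map_christoffel h1 (h2.differentiableAt (by simp)) (h3.differentiableAt (by simp))
      h4 h5 h6 b c
  have hdu : DifferentiableAt ℝ (fderiv ℝ u) x :=
    differentiableAt_fderiv hu
  have hdP : DifferentiableAt ℝ (fderiv ℝ P) x :=
    differentiableAt_fderiv hP
  have happ (z : E n) := hPd.hasFDerivAt.clm_apply (hasFDerivAt_const z x)
  have hd2 := ((((hdP.hasFDerivAt.clm_apply (hasFDerivAt_const b x)).clm_apply
      (hasFDerivAt_const c x)).add
    ((hdu.hasFDerivAt.clm_apply (hasFDerivAt_const b x)).smul (happ c))).add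
    ((hdu.hasFDerivAt.clm_apply (hasFDerivAt_const c x)).smul (happ b))).sub
    (((happ b).inner ℝ (happ c)).smul hNd.hasFDerivAt)
  -- Near `x`, `Γ(b, c)` is `P⁻¹` applied to the right-hand side of `hΓ`, and inversion is smooth at
  -- invertible maps.
  have hΓd : DifferentiableAt ℝ (fun y => christoffel G y b c) x := by
    have hinv : DifferentiableAt ℝ (fun y => (P y).inverse) x :=
      (ContDiffAt.comp x (hi.contDiffAt_map_inverse (n := ∞)) hP).differentiableAt (by simp)
    refine (hinv.clm_apply hd2.differentiableAt).congr_of_eventuallyEq ?_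
    filter_upwards [hΓ, eventually_isInvertible hP.continuousAt hi] with y hy hy'
    exact (hy'.inverse_apply_eq.2 (hy b c).symm).symm
  have hd1 := hPd.hasFDerivAt.clm_apply hΓd.hasFDerivAt
  have h3 := DFunLike.congr_fun (hd1.unique (hd2.congr_of_eventuallyEq
    (hΓ.mono fun y hy => hy b c))) a
  simp at h3
  have hW' : P x (christoffel G x b c) = W := by rw [hΓ.self_of_nhds, hW]
  -- The term `DP(a, Γ(b, c))` of `P Γ(a, Γ(b, c))` cancels the one produced by the product rule in
  -- `h3`.
  rw [map_add, hΓ.self_of_nhds a, hW', ← hN.self_of_nhds (christoffel G x b c), hW']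
  rw [eq_sub_of_add_eq h3]
  module

/-- Antisymmetrising `map_covDeriv_christoffel` in `a, b` kills the second derivatives of `P`; what
survives, paired with `P t`, is quadratic in `du` or linear in the Hessian. -/
lemma localRm_exp_smul {P : E n → E n →L[ℝ] E n} {u : E n → ℝ}
    {G G₁ : E n → E n →L[ℝ] E n →L[ℝ] ℝ} {x : E n}
    (hG : G =ᶠ[𝓝 x] fun z => Real.exp (2 * u z) • innerPullback (P z))
    (hG₁ : G₁ =ᶠ[𝓝 x] fun z => innerPullback (P z))
    (hP : ContDiffAt ℝ ∞ P x) (hu : ContDiffAt ℝ ∞ u x) (hi : (P x).IsInvertible)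
    (hs : ∀ᶠ y in 𝓝 x, ∀ a b, fderiv ℝ P y a b = fderiv ℝ P y b a) (a b c t : E n) :
    localRm G x a b c t = - kulkarniNomizu (fun v w => G x v w)
      (fun v w => localHess G₁ u x v w - fderiv ℝ u x v * fderiv ℝ u x w
        + (1 / 2 : ℝ) * G₁ x (localGrad G₁ u x) (localGrad G₁ u x) * G₁ x v w) a b c t := by
  obtain ⟨N, hNd, hN, hNx⟩ := exists_gradient hP hu hi
  have hG₁x : G₁ x = innerPullback (P x) := hG₁.self_of_nhds
  have hgrad : P x (localGrad G₁ u x) = N x := by rw [localGrad, hG₁x, hNx]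
  have hu2 : ∀ a b, fderiv ℝ (fderiv ℝ u) x a b = fderiv ℝ (fderiv ℝ u) x b a :=
    fun a b => (hu.isSymmSndFDerivAt (by simpa using two_le_infty)) a b
  have hP2 : ∀ a b, fderiv ℝ (fderiv ℝ P) x a b = fderiv ℝ (fderiv ℝ P) x b a :=
    fun a b => (hP.isSymmSndFDerivAt (by simpa using two_le_infty)) a b
  have hs' := hs.self_of_nhds
  have hN' := hN.self_of_nhds
  have hH := localHess_innerPullback hG₁ (hP.differentiableAt (by simp)) hi hs' hN'
  have hDN := inner_fderiv_gradient hP hu hNd hN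
  have key := map_covDeriv_christoffel hG hP hu hi hs hNd hN
  have hN'' (z : E n) : (inner ℝ (P x z) (N x) : ℝ) = fderiv ℝ u x z := by
    rw [real_inner_comm, hN']
  have hQ (a b z : E n) : (inner ℝ (fderiv ℝ P x a b) (P x z) : ℝ) =
      inner ℝ (P x z) (fderiv ℝ P x a b) := real_inner_comm _ _
  rw [localRm, curvature_const, hG.self_of_nhds]
  simp only [smul_apply, innerPullback_apply, smul_eq_mul, kulkarniNomizu, hH, hG₁x, hgrad]
  rw [map_sub, key a b c _ rfl, key b a c _ rfl, hP2 b a, hu2 b a, hs' b a]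
  simp only [inner_add_left, inner_sub_left, inner_add_right, inner_sub_right, inner_smul_left,
    inner_smul_right, conj_trivial, hN', hN'', hQ, hDN]
  rw [real_inner_comm (P x a) (P x b)]
  ring

/-! ### Traces and scalar curvature -/

lemma traceWrt_add (G : E n →L[ℝ] E n →L[ℝ] ℝ) (T T' : E n → E n → ℝ) :
    traceWrt G (fun v w => T v w + T' v w) = traceWrt G T + traceWrt G T' := by
  simp [traceWrt, mul_add, Finset.sum_add_distrib]

lemma traceWrt_sub (G : E n →L[ℝ] E n →L[ℝ] ℝ) (T T' : E n → E n → ℝ) :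
    traceWrt G (fun v w => T v w - T' v w) = traceWrt G T - traceWrt G T' := by
  simp [traceWrt, mul_sub, Finset.sum_sub_distrib]

lemma traceWrt_const_mul (G : E n →L[ℝ] E n →L[ℝ] ℝ) (c : ℝ) (T : E n → E n → ℝ) :
    traceWrt G (fun v w => c * T v w) = c * traceWrt G T := by
  simp [traceWrt, mul_left_comm _ c, Finset.mul_sum]

lemma traceWrt_neg (G : E n →L[ℝ] E n →L[ℝ] ℝ) (T : E n → E n → ℝ) :
    traceWrt G (fun v w => - T v w) = - traceWrt G T := by
  simp [traceWrt]

lemma apply_inverse {G : E n →L[ℝ] E n →L[ℝ] ℝ} (hG : G.IsInvertible) (l : E n →L[ℝ] ℝ) :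
    G (G.inverse l) = l :=
  (hG.inverse_apply_eq.1 rfl).symm

lemma smul_inverse {G : E n →L[ℝ] E n →L[ℝ] ℝ} (hG : G.IsInvertible) {c : ℝ} (hc : c ≠ 0)
    (hcG : (c • G).IsInvertible) (l : E n →L[ℝ] ℝ) :
    (c • G).inverse l = c⁻¹ • G.inverse l := by
  refine hcG.inverse_apply_eq.2 ?_
  ext w
  simp [apply_inverse hG, hc]

lemma traceWrt_smul {G : E n →L[ℝ] E n →L[ℝ] ℝ} (hG : G.IsInvertible) {c : ℝ} (hc : c ≠ 0)
    (hcG : (c • G).IsInvertible) (T : E n → E n → ℝ) :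
    traceWrt (c • G) T = c⁻¹ * traceWrt G T := by
  simp [traceWrt, smul_inverse hG hc hcG, Finset.mul_sum, mul_assoc]

lemma sum_coord_smul_single (v : E n) :
    ∑ i, v i • (EuclideanSpace.single i 1 : E n) = v := by
  ext j
  simp [Finset.sum_apply, Pi.single_apply]

/-- Contraction of the second index through the inverse metric. -/
lemma traceWrt_eq_sum (G : E n →L[ℝ] E n →L[ℝ] ℝ) {T : E n → E n → ℝ}
    (hT : ∀ v, IsLinearMap ℝ (T v)) :
    traceWrt G T = ∑ i : Fin n,
      T (EuclideanSpace.single i 1) (G.inverse (EuclideanSpace.proj i)) := by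
  refine Finset.sum_congr rfl fun i _ => ?_
  conv_rhs => rw [← sum_coord_smul_single (G.inverse (EuclideanSpace.proj i))]
  have := map_sum ((hT (EuclideanSpace.single i 1)).mk' _)
    (fun j => G.inverse (EuclideanSpace.proj i) j • (EuclideanSpace.single j 1 : E n)) Finset.univ
  simp only [IsLinearMap.mk'_apply, map_smul, smul_eq_mul] at this
  rw [this]

lemma apply_inverse_proj {G : E n →L[ℝ] E n →L[ℝ] ℝ} (hG : G.IsInvertible)
    (hsym : ∀ v w, G v w = G w v) (v : E n) (i : Fin n) :
    G v (G.inverse (EuclideanSpace.proj i)) = v i := by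
  rw [hsym, apply_inverse hG]
  rfl

lemma traceWrt_mul_right {G : E n →L[ℝ] E n →L[ℝ] ℝ} (hG : G.IsInvertible)
    (hsym : ∀ v w, G v w = G w v) {l : E n → ℝ} (hl : IsLinearMap ℝ l) (v : E n) :
    traceWrt G (fun a b => l a * G v b) = l v := by
  rw [traceWrt_eq_sum]
  · simp only [apply_inverse_proj hG hsym]
    have := map_sum (hl.mk' _) (fun j => v j • (EuclideanSpace.single j 1 : E n)) Finset.univ
    rw [sum_coord_smul_single] at this
    simp only [IsLinearMap.mk'_apply, hl.map_smul, smul_eq_mul] at this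
    rw [this]
    exact Finset.sum_congr rfl fun _ _ => mul_comm _ _
  · exact fun a => ⟨fun x y => by simp [mul_add], fun c x => by simp [mul_left_comm]⟩

lemma traceWrt_mul_left {G : E n →L[ℝ] E n →L[ℝ] ℝ} (hG : G.IsInvertible)
    {l : E n → ℝ} (hl : IsLinearMap ℝ l) (v : E n) :
    traceWrt G (fun a b => G v a * l b) = l v := by
  rw [traceWrt_eq_sum]
  -- Expand the covector `G v` in the coordinate covectors, then raise the index.
  · have h1 : v = ∑ i, G v (EuclideanSpace.single i 1) •
        G.inverse (EuclideanSpace.proj i) := by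
      have h2 : G v = ∑ i, G v (EuclideanSpace.single i 1) •
          (EuclideanSpace.proj i : E n →L[ℝ] ℝ) := by
        ext w
        conv_lhs => rw [← sum_coord_smul_single w]
        simp [mul_comm]
      have h3 : G.inverse (G v) = v := hG.inverse_apply_eq.2 rfl
      conv_lhs => rw [← h3, h2]
      simp
    have := map_sum (hl.mk' _) (fun i => G v (EuclideanSpace.single i 1) •
        G.inverse (EuclideanSpace.proj i)) Finset.univ
    rw [← h1] at this
    simp only [IsLinearMap.mk'_apply, hl.map_smul, smul_eq_mul] at this
    exact this.symm
  · exact fun a => ⟨fun x y => by simp [mul_add, hl.map_add],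
      fun c x => by simp [mul_left_comm, hl.map_smul]⟩

lemma traceWrt_self {G : E n →L[ℝ] E n →L[ℝ] ℝ} (hG : G.IsInvertible)
    (hsym : ∀ v w, G v w = G w v) : traceWrt G (fun v w => G v w) = n := by
  rw [traceWrt_eq_sum _ fun v => ⟨by simp, by simp⟩]
  simp [apply_inverse_proj hG hsym]

/-- The scalar curvature, if the curvature tensor is `-G ⊙ s`. -/
lemma localScalar_of_localRm {G : E n → E n →L[ℝ] E n →L[ℝ] ℝ} {x : E n}
    (hG : (G x).IsInvertible) (hsym : ∀ v w, G x v w = G x w v) {s : E n → E n → ℝ}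
    (hs₁ : ∀ w, IsLinearMap ℝ (fun v => s v w)) (hs₂ : ∀ v, IsLinearMap ℝ (s v))
    (h : ∀ a b c t, localRm G x a b c t = -kulkarniNomizu (fun v w => G x v w) s a b c t) :
    localScalar G x = -2 * ((n : ℝ) - 1) * traceWrt (G x) s := by
  have hric : localRicci G x = fun v w =>
      (2 - (n : ℝ)) * s v w - traceWrt (G x) s * G x v w := by
    ext v w
    simp only [localRicci, h, kulkarniNomizu]
    rw [traceWrt_neg, traceWrt_sub, traceWrt_sub, traceWrt_add, traceWrt_const_mul]
    simp only [mul_comm _ (s v w), hsym _ w, mul_comm (G x v _)]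
    rw [traceWrt_const_mul, traceWrt_self hG hsym, traceWrt_mul_left hG (hs₂ v),
      traceWrt_mul_right hG hsym (hs₁ w)]
    ring
  rw [localScalar, hric, traceWrt_sub, traceWrt_const_mul, traceWrt_const_mul,
    traceWrt_self hG hsym]
  ring

/-- The tensor paired with `G` here equals `2 s`: the scalar curvature supplies the trace part of
`s`, and `OS` its trace-free part. -/
theorem localRm_eq_kulkarniNomizu_localOS (hn : 2 ≤ n) {P : E n → E n →L[ℝ] E n} {u : E n → ℝ}
    {G G₁ : E n → E n →L[ℝ] E n →L[ℝ] ℝ} {x : E n}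
    (hG : G =ᶠ[𝓝 x] fun z => Real.exp (2 * u z) • innerPullback (P z))
    (hG₁ : G₁ =ᶠ[𝓝 x] fun z => innerPullback (P z))
    (hP : ContDiffAt ℝ ∞ P x) (hu : ContDiffAt ℝ ∞ u x) (hi : (P x).IsInvertible)
    (hs : ∀ᶠ y in 𝓝 x, ∀ a b, fderiv ℝ P y a b = fderiv ℝ P y b a) (a b c t : E n) :
    localRm G x a b c t = -(1 / 2 : ℝ) * kulkarniNomizu (fun v w => G x v w)
      (fun v w => 2 * localOS G₁ u x v w
        - localScalar G x / ((n : ℝ) * ((n : ℝ) - 1)) * G x v w) a b c t := by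
  have hRm := localRm_exp_smul hG hG₁ hP hu hi hs
  obtain ⟨N, hNd, hN, hNx⟩ := exists_gradient hP hu hi
  have hH := localHess_innerPullback hG₁ (hP.differentiableAt (by simp)) hi hs.self_of_nhds
    hN.self_of_nhds
  have hG₁x : G₁ x = innerPullback (P x) := hG₁.self_of_nhds
  have hGx : G x = Real.exp (2 * u x) • G₁ x := by rw [hG₁x]; exact hG.self_of_nhds
  have he : Real.exp (2 * u x) ≠ 0 := (Real.exp_pos _).ne'
  have hG₁i : (G₁ x).IsInvertible := hG₁x ▸ isInvertible_innerPullback hi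
  have hGi : (Real.exp (2 * u x) • G₁ x).IsInvertible :=
    hG₁x ▸ isInvertible_smul_innerPullback hi he
  have hsym₁ : ∀ v w, G₁ x v w = G₁ x w v := fun v w => by
    simp [hG₁x, real_inner_comm]
  have hsym : ∀ v w, G x v w = G x w v := fun v w => by simp [hGx, hsym₁ v w]
  set q := G₁ x (localGrad G₁ u x) (localGrad G₁ u x) with hq
  set s : E n → E n → ℝ := fun v w => localHess G₁ u x v w - fderiv ℝ u x v * fderiv ℝ u x w
        + (1 / 2 : ℝ) * q * G₁ x v w with hsdef
  have hs₁ : ∀ w, IsLinearMap ℝ (fun v => s v w) := fun w =>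
    ⟨fun v v' => by simp [s, hH, inner_add_right]; ring,
      fun r v => by simp [s, hH, inner_smul_right]; ring⟩
  have hs₂ : ∀ v, IsLinearMap ℝ (s v) := fun v =>
    ⟨fun w w' => by simp [s, hH, inner_add_right]; ring,
      fun r w => by simp [s, hH, inner_smul_right]; ring⟩
  have hgrad : ∀ z, G₁ x (localGrad G₁ u x) z = fderiv ℝ u x z := fun z =>
    DFunLike.congr_fun (apply_inverse hG₁i _) z
  have hdudu : traceWrt (G₁ x) (fun v w => fderiv ℝ u x v * fderiv ℝ u x w) = q := by
    -- Taking `v` to be the gradient turns `G₁ v` into `du`.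
    have := traceWrt_mul_left hG₁i (l := fderiv ℝ u x) ⟨by simp, by simp⟩ (localGrad G₁ u x)
    simpa only [hgrad, hq] using this
  have htr : traceWrt (G₁ x) s = localLaplacian G₁ u x - q + (1 / 2 : ℝ) * q * n := by
    rw [hsdef, traceWrt_add, traceWrt_sub, traceWrt_const_mul, traceWrt_self hG₁i hsym₁, hdudu]
    rfl
  have hscal := localScalar_of_localRm (hGx ▸ hGi) hsym hs₁ hs₂ hRm
  have htr' : traceWrt (G x) s = (Real.exp (2 * u x))⁻¹ * traceWrt (G₁ x) s := by
    rw [hGx, traceWrt_smul hG₁i he hGi]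
  have hn0 : (n : ℝ) ≠ 0 := by positivity
  have hn1 : (n : ℝ) - 1 ≠ 0 := by
    have : (2 : ℝ) ≤ n := by exact_mod_cast hn
    linarith
  have hII : (fun v w => 2 * localOS G₁ u x v w
        - localScalar G x / ((n : ℝ) * ((n : ℝ) - 1)) * G x v w) = fun v w => 2 * s v w := by
    ext v w
    have hGvw : G x v w = Real.exp (2 * u x) * G₁ x v w := by simp [hGx]
    rw [hscal, htr', htr, hGvw, localOS, ← hq]
    simp only [s]
    field_simp
    ring
  rw [hRm, hII]
  simp only [kulkarniNomizu]
  ring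

end Coordinates

/-! ### From coordinates to the manifold -/

section Manifold

variable {n : ℕ} {M : Type*} [TopologicalSpace M] [ChartedSpace (E n) M]

lemma mdifferentiable_of_mem_maximalAtlas [IsManifold (𝓡 n) ∞ M]
    {φ : OpenPartialHomeomorph M (E n)} (hφ : φ ∈ IsManifold.maximalAtlas (𝓡 n) ∞ M) :
    φ.MDifferentiable (𝓡 n) (𝓡 n) :=
  ⟨(contMDiffOn_of_mem_maximalAtlas hφ).mdifferentiableOn (by simp),
    (contMDiffOn_symm_of_mem_maximalAtlas hφ).mdifferentiableOn (by simp)⟩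

lemma inChart_apply (e : OpenPartialHomeomorph M (E n)) (h : BilinField n M) (y v w : E n) :
    inChart e h y v w = h (e.symm y) (mfderiv (𝓡 n) (𝓡 n) e.symm y v)
      (mfderiv (𝓡 n) (𝓡 n) e.symm y w) := rfl

/-- A pulled back metric read in a chart is the pullback by the transition map. -/
lemma inChart_pullbackEuclidean {e φ : OpenPartialHomeomorph M (E n)}
    (he : e.MDifferentiable (𝓡 n) (𝓡 n)) (hφ : φ.MDifferentiable (𝓡 n) (𝓡 n)) {y : E n}
    (hy : y ∈ e.target) (hy' : e.symm y ∈ φ.source) :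
    inChart e (pullbackEuclidean φ) y = innerPullback (fderiv ℝ (φ ∘ e.symm) y) := by
  have h := mfderiv_comp y (hφ.mdifferentiableAt hy') (he.symm.mdifferentiableAt hy)
  rw [mfderiv_eq_fderiv] at h
  rw [h]
  rfl

lemma inChart_chartAt_coord [IsManifold (𝓡 n) ∞ M] (g : BilinField n M) (p : M)
    (X Y : TangentSpace (𝓡 n) p) :
    inChart (chartAt (E n) p) g (chartAt (E n) p p) (coord p X) (coord p Y) = g p X Y := by
  have : IsManifold (𝓡 n) 1 M := .of_le (n := ∞) (by simp)
  have he : (chartAt (E n) p).MDifferentiable (𝓡 n) (𝓡 n) := mdifferentiable_chart p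
  have hp := mem_chart_source (E n) p
  have h (X : TangentSpace (𝓡 n) p) :
      mfderiv (𝓡 n) (𝓡 n) (chartAt (E n) p).symm (chartAt (E n) p p) (coord p X) = X :=
    DFunLike.congr_fun (he.symm_comp_deriv hp) X
  rw [inChart_apply, h, h, (chartAt (E n) p).left_inv hp]

theorem Rm_eq_of_isConformalChartWith [IsManifold (𝓡 n) ∞ M] (hn : 2 ≤ n) {g : BilinField n M}
    {φ : OpenPartialHomeomorph M (E n)} {u : M → ℝ} (h : IsConformalChartWith g φ u) {p : M}
    (hp : p ∈ φ.source) (X Y Z W : TangentSpace (𝓡 n) p) :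
    Rm g p X Y Z W = -(1 / 2 : ℝ) * kulkarniNomizu (fun v w => g p v w)
      (fun v w => 2 * OS (pullbackEuclidean φ) u p v w
        - scalarCurvature g p / ((n : ℝ) * ((n : ℝ) - 1)) * g p v w) X Y Z W := by
  set e := chartAt (E n) p with he
  have hpe : p ∈ e.source := mem_chart_source (E n) p
  have hpt : e p ∈ e.target := e.map_source hpe
  have hepp : e.symm (e p) = p := e.left_inv hpe
  have heA : e ∈ IsManifold.maximalAtlas (𝓡 n) ∞ M := IsManifold.chart_mem_maximalAtlas p
  have hed := mdifferentiable_of_mem_maximalAtlas heA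
  have hφd := mdifferentiable_of_mem_maximalAtlas h.mem_maximalAtlas
  have hev : ∀ᶠ y in 𝓝 (e p), y ∈ e.target ∧ e.symm y ∈ φ.source :=
    (e.open_target.eventually_mem hpt).and <| (e.continuousAt_symm hpt).eventually <|
      φ.open_source.mem_nhds (hepp.symm ▸ hp)
  have hes : ContMDiffAt (𝓡 n) (𝓡 n) ∞ e.symm (e p) :=
    contMDiffAt_symm_of_mem_maximalAtlas heA hpt
  have hψ : ContDiffAt ℝ ∞ (φ ∘ e.symm) (e p) := by
    rw [← contMDiffAt_iff_contDiffAt]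
    exact ContMDiffAt.comp_of_eq (contMDiffAt_of_mem_maximalAtlas h.mem_maximalAtlas hp) hes hepp
  have hu : ContDiffAt ℝ ∞ (u ∘ e.symm) (e p) := by
    rw [← contMDiffAt_iff_contDiffAt]
    exact ContMDiffAt.comp_of_eq
      (h.contMDiffOn.contMDiffAt (φ.open_source.mem_nhds hp)) hes hepp
  have hG₁ : inChart e (pullbackEuclidean φ) =ᶠ[𝓝 (e p)]
      fun y => innerPullback (fderiv ℝ (φ ∘ e.symm) y) :=
    hev.mono fun y hy => inChart_pullbackEuclidean hed hφd hy.1 hy.2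
  have hG : inChart e g =ᶠ[𝓝 (e p)] fun y =>
      Real.exp (2 * (u ∘ e.symm) y) • innerPullback (fderiv ℝ (φ ∘ e.symm) y) := by
    filter_upwards [hev] with y hy
    rw [← inChart_pullbackEuclidean hed hφd hy.1 hy.2]
    ext v w
    exact h.eq_exp _ hy.2 _ _
  have hi : (fderiv ℝ (φ ∘ e.symm) (e p)).IsInvertible := by
    have hd := hed.symm.trans hφd
    have hm : e p ∈ (e.symm.trans φ).source := by simp [hpt, hepp, hp]
    refine ⟨hd.mfderiv hm, ?_⟩
    rw [← mfderiv_eq_fderiv]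
    rfl
  -- Here `P` is the derivative of the transition map, so `DP` is a second derivative.
  have hs : ∀ᶠ y in 𝓝 (e p), ∀ a b, fderiv ℝ (fderiv ℝ (φ ∘ e.symm)) y a b =
      fderiv ℝ (fderiv ℝ (φ ∘ e.symm)) y b a := by
    filter_upwards [(hψ.of_le two_le_infty).eventually (by simp)] with y hy a b
    exact (hy.isSymmSndFDerivAt (by simp)) a b
  have key := localRm_eq_kulkarniNomizu_localOS hn hG hG₁
    (hψ.fderiv_right (by simp)) hu hi hs (coord p X) (coord p Y) (coord p Z) (coord p W)
  simp only [kulkarniNomizu, he, inChart_chartAt_coord] at key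
  exact key

theorem solvesGaussAtInfinity_of_OSRel [IsManifold (𝓡 n) ∞ M] (hn : 2 ≤ n) {g : BilinField n M}
    {B : (p : M) → TangentSpace (𝓡 n) p →L[ℝ] TangentSpace (𝓡 n) p}
    {𝒜 : Set (OpenPartialHomeomorph M (E n))} (h𝒜 : 𝒜 ⊆ conformalCharts g)
    (hcov : ∀ p : M, ∃ φ ∈ 𝒜, p ∈ φ.source)
    (hB : ∀ (p : M) (X Y : TangentSpace (𝓡 n) p), lower g B p X Y =
      2 * OSRel g 𝒜 p X Y - scalarCurvature g p / ((n : ℝ) * ((n : ℝ) - 1)) * g p X Y) :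
    SolvesGaussAtInfinity g B := by
  intro p X Y Z W
  have h : ∃ c : OpenPartialHomeomorph M (E n) × (M → ℝ),
      c.1 ∈ 𝒜 ∧ p ∈ c.1.source ∧ IsConformalChartWith g c.1 c.2 := by
    obtain ⟨φ, hφ, hp⟩ := hcov p
    obtain ⟨u, hu⟩ := h𝒜 hφ
    exact ⟨(φ, u), hφ, hp, hu⟩
  have hl : lower g B p = fun v w => 2 * OS (pullbackEuclidean h.choose.1) h.choose.2 p v w
      - scalarCurvature g p / ((n : ℝ) * ((n : ℝ) - 1)) * g p v w := by
    ext v w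
    rw [hB, OSRel, dif_pos h]
  rw [hl]
  exact Rm_eq_of_isConformalChartWith hn h.choose_spec.2.2 h.choose_spec.2.1 X Y Z W

end Manifold

end GaussInfinity

end

theorem theorem4p3 {n : ℕ} {M : Type*} [TopologicalSpace M]
    [ChartedSpace (EuclideanSpace ℝ (Fin n)) M] [IsManifold (𝓡 n) ∞ M]
    (g : Bundle.ContMDiffRiemannianMetric (𝓡 n) ∞ (EuclideanSpace ℝ (Fin n))
      (fun p : M => TangentSpace (𝓡 n) p))
    (B : (p : M) → TangentSpace (𝓡 n) p →L[ℝ] TangentSpace (𝓡 n) p) :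
    (3 ≤ n → GaussInfinity.IsLocallyConformallyFlat g.inner →
      (∀ (p : M) (X Y : TangentSpace (𝓡 n) p),
        GaussInfinity.lower g.inner B p X Y =
          2 * GaussInfinity.OSGlobal g.inner p X Y
            - GaussInfinity.scalarCurvature g.inner p / ((n : ℝ) * ((n : ℝ) - 1))
              * g.inner p X Y) →
      GaussInfinity.SolvesGaussAtInfinity g.inner B) ∧
    (n = 2 → ∀ 𝒜 : Set (OpenPartialHomeomorph M (EuclideanSpace ℝ (Fin n))),
      GaussInfinity.IsMobiusAtlas g.inner 𝒜 →
      (∀ (p : M) (X Y : TangentSpace (𝓡 n) p),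
        GaussInfinity.lower g.inner B p X Y =
          2 * GaussInfinity.OSRel g.inner 𝒜 p X Y
            - GaussInfinity.scalarCurvature g.inner p / ((n : ℝ) * ((n : ℝ) - 1))
              * g.inner p X Y) →
      GaussInfinity.SolvesGaussAtInfinity g.inner B) := by
  refine ⟨fun hn hflat hB => ?_, fun hn 𝒜 h𝒜 hB => ?_⟩
  · exact GaussInfinity.solvesGaussAtInfinity_of_OSRel (by omega) subset_rfl hflat hB
  · exact GaussInfinity.solvesGaussAtInfinity_of_OSRel hn.ge h𝒜.conformal h𝒜.covers hB
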